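/- **Theorem (Universality of $\lambda_{Q\#}$).** Write $M_{2^n}$ for the algebra of complex $2^n\times 2^n$ matrices. Let $k, p, n_1,\dots,n_k\in\mathbb N$ and let $$f : M_{2^{n_1}}\oplus\cdots\oplus M_{2^{n_k}}\longrightarrow M_{2^p}$$ be linear, completely positive and unital, i.e. the Heisenberg-picture form of a trace-preserving superoperator from $p$ qubits to a classical outcome $i\in\{1,\dots,k\}$ together with $n_i$ qubits. Then some $\lambda_{Q\#}$ term implements $f$. In detail: *The language.* $\lambda_{Q\#}$ is the call-by-value simply typed $\lambda$-calculus with types $\tau ::= \mathsf{qref}[q]\mid\tau\to\tau\mid\mathsf{cmd}(\tau)\mid\prod_{i<n}\tau_i\mid\mathsf{bool}\mid\mathsf{unit}$, with $\mathsf{qref}[q]$ the singleton type of references to the logical qubit $q$, and with encapsulated commands. Commands are $\mathsf{ret}(e)$; $\mathsf{bnd}(e;x.m)$ (run the command encapsulated by $e$, bind its result to $x$, run $m$); $\mathsf{new}(x.m)$ (allocate a qubit in state $|0\rangle$, run $m$ with a reference $x$ to it, and trace the qubit out at the end of its scope); $U(e)$ for a unitary $U$ on any number of qubits; $D(U,V)(e_1,e_2)$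 for the block diagonal unitary $U\oplus V$ with control $e_1$; and $\mathsf{meas}(e)$. Typing $\Gamma\vdash_\Sigma m\mathrel{\dot\sim}\tau$ is relative to a signature $\Sigma$ of active qubit symbols. Gates may only be applied to references to distinct active qubits. The type of a value returned by $\mathsf{new}(x.m)$ must contain no qubit references, functions or commands. Executing a command on a store of qubits yields a finite family of branches $(v,K)$, where $v$ is the returned value and $K$ the Kraus operator on the store. *The claim.* For every $N$ with $p\le N$ and $n_i\le N$ for all $i$, there is a $\lambda_{Q\#}$ command $m$ with $$a_0:\mathsf{qref}[q_0],\dots,a_{N-1}:\mathsf{qref}[q_{N-1}]\ \vdash_{q_0,\dots,q_{N-1}}\ m\ \mathrel{\dot\sim}\ \textstyle\prod_{i\le k}\mathsf{bool}$$ that, run on the qubits $q_0,\dots,q_{N-1}$, has branches $(v_j,K_j)_j$ such that for all $A=(A_1,\dots,A_k)$ with $A_i\in M_{2^{n_i}}$ $$\sum_{i=1}^{k}\ \sum_{j\,:\,v_j=\mathrm{out}_i}K_j^\dagger\,\bigl(A_i\otimes 1_{2^{N-n_i}}\bigr)\,K_j \;=\; f(A)\otimes 1_{2^{N-p}} ,$$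 where $\mathrm{out}_i$ is the tuple of $k$ booleans whose $i$-th entry is true and all others false. In words: the input is held by the first $p$ qubits, $m$ reports the outcome $i$ and leaves the output on the first $n_i$ qubits, the remaining qubits are forgotten, and the result does not depend on the initial state of the qubits beyond the first $p$. -/

import Mathlib

open scoped CStarAlgebra ComplexOrder Matrix

namespace LambdaQ

/-! ## Syntax

Qubit symbols are natural numbers. A signature `q₀, …, qₙ₋₁` of active symbols is represented by
its length `n`; the symbol introduced by an allocation inside a signature of length `n` is `n`
(this picks one representative up to renaming of bound symbols). Variables are de Bruijn indices.
-/

/-- The computational basis of `n` qubits, a set of size `2 ^ n`. -/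
abbrev Bits (n : ℕ) : Type := Fin n → Bool

/-- Types. -/
inductive Ty : Type
  /-- the singleton type of references to the logical qubit `q` -/
  | qref (q : ℕ) : Ty
  | arr (dom cod : Ty) : Ty
  | cmd (res : Ty) : Ty
  | prod (k : ℕ) (comp : Fin k → Ty) : Ty
  | bool : Ty
  | unit : Ty

mutual

/-- Pure expressions. The expression `qloc q` is the run-time value of a reference to the active
qubit symbol `q`; it does not occur in source programs, see `Exp.Source`. -/
inductive Exp : Type
  | var (x : ℕ) : Exp
  /-- `let e₁ be x in e₂`; binds one variable in `body` -/
  | letBe (e : Exp) (body : Exp) : Exp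
  /-- binds one variable in `body` -/
  | lam (body : Exp) : Exp
  | app (fn : Exp) (arg : Exp) : Exp
  | cmd (m : Cmd) : Exp
  | tuple (k : ℕ) (comp : Fin k → Exp) : Exp
  | proj (e : Exp) (i : ℕ) : Exp
  | tt : Exp
  | ff : Exp
  | ite (c : Exp) (e₁ : Exp) (e₂ : Exp) : Exp
  | unit : Exp
  | qloc (q : ℕ) : Exp

/-- Commands. -/
inductive Cmd : Type
  | ret (e : Exp) : Cmd
  /-- run the command that `e` encapsulates, bind its result to one variable in `m` -/
  | bnd (e : Exp) (m : Cmd) : Cmd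
  /-- allocate a qubit, bind a reference to it to one variable in `m`, and run `m` -/
  | new (m : Cmd) : Cmd
  | gate (k : ℕ) (U : Matrix.unitaryGroup (Bits k) ℂ) (e : Exp) : Cmd
  /-- application of the block diagonal gate `D(U, V) = U ⊕ V`, with control qubit `e₁` -/
  | diag (k : ℕ) (U V : Matrix.unitaryGroup (Bits k) ℂ) (e₁ : Exp) (e₂ : Exp) : Cmd
  | meas (e : Exp) : Cmd

end

mutual

/-- `e` is in the source grammar: `qloc` does not occur in it. -/
def Exp.Source : Exp → Prop
  | .var _ => True
  | .letBe e b => e.Source ∧ b.Source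
  | .lam b => b.Source
  | .app e₁ e₂ => e₁.Source ∧ e₂.Source
  | .cmd m => m.Source
  | .tuple _ es => ∀ i, (es i).Source
  | .proj e _ => e.Source
  | .tt => True
  | .ff => True
  | .ite c e₁ e₂ => c.Source ∧ e₁.Source ∧ e₂.Source
  | .unit => True
  | .qloc _ => False

/-- `m` is in the source grammar: `qloc` does not occur in it. -/
def Cmd.Source : Cmd → Prop
  | .ret e => e.Source
  | .bnd e m => e.Source ∧ m.Source
  | .new m => m.Source
  | .gate _ _ e => e.Source
  | .diag _ _ _ e₁ e₂ => e₁.Source ∧ e₂.Source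
  | .meas e => e.Source

end

/-! ## Substitution -/

/-- Extend a renaming under a binder. -/
def liftRen (ξ : ℕ → ℕ) : ℕ → ℕ
  | 0 => 0
  | x + 1 => ξ x + 1

mutual

/-- Renaming of free variables in expressions. -/
def Exp.rename : Exp → (ℕ → ℕ) → Exp
  | .var x, ξ => .var (ξ x)
  | .letBe e b, ξ => .letBe (e.rename ξ) (b.rename (liftRen ξ))
  | .lam b, ξ => .lam (b.rename (liftRen ξ))
  | .app e₁ e₂, ξ => .app (e₁.rename ξ) (e₂.rename ξ)
  | .cmd m, ξ => .cmd (m.rename ξ)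
  | .tuple k es, ξ => .tuple k fun i => (es i).rename ξ
  | .proj e i, ξ => .proj (e.rename ξ) i
  | .tt, _ => .tt
  | .ff, _ => .ff
  | .ite c e₁ e₂, ξ => .ite (c.rename ξ) (e₁.rename ξ) (e₂.rename ξ)
  | .unit, _ => .unit
  | .qloc q, _ => .qloc q

/-- Renaming of free variables in commands. -/
def Cmd.rename : Cmd → (ℕ → ℕ) → Cmd
  | .ret e, ξ => .ret (e.rename ξ)
  | .bnd e m, ξ => .bnd (e.rename ξ) (m.rename (liftRen ξ))
  | .new m, ξ => .new (m.rename (liftRen ξ))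
  | .gate k U e, ξ => .gate k U (e.rename ξ)
  | .diag k U V e₁ e₂, ξ => .diag k U V (e₁.rename ξ) (e₂.rename ξ)
  | .meas e, ξ => .meas (e.rename ξ)

end

/-- Extend a substitution under a binder. -/
def liftSub (σ : ℕ → Exp) : ℕ → Exp
  | 0 => .var 0
  | x + 1 => (σ x).rename Nat.succ

mutual

/-- Capture-avoiding simultaneous substitution in expressions. -/
def Exp.subst : Exp → (ℕ → Exp) → Exp
  | .var x, σ => σ x
  | .letBe e b, σ => .letBe (e.subst σ) (b.subst (liftSub σ))
  | .lam b, σ => .lam (b.subst (liftSub σ))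
  | .app e₁ e₂, σ => .app (e₁.subst σ) (e₂.subst σ)
  | .cmd m, σ => .cmd (m.subst σ)
  | .tuple k es, σ => .tuple k fun i => (es i).subst σ
  | .proj e i, σ => .proj (e.subst σ) i
  | .tt, _ => .tt
  | .ff, _ => .ff
  | .ite c e₁ e₂, σ => .ite (c.subst σ) (e₁.subst σ) (e₂.subst σ)
  | .unit, _ => .unit
  | .qloc q, _ => .qloc q

/-- Capture-avoiding simultaneous substitution in commands. -/
def Cmd.subst : Cmd → (ℕ → Exp) → Cmd
  | .ret e, σ => .ret (e.subst σ)
  | .bnd e m, σ => .bnd (e.subst σ) (m.subst (liftSub σ))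
  | .new m, σ => .new (m.subst (liftSub σ))
  | .gate k U e, σ => .gate k U (e.subst σ)
  | .diag k U V e₁ e₂, σ => .diag k U V (e₁.subst σ) (e₂.subst σ)
  | .meas e, σ => .meas (e.subst σ)

end

/-- The substitution that replaces the variable bound last by `v`. -/
def single (v : Exp) : ℕ → Exp
  | 0 => v
  | x + 1 => .var x

/-! ## Static semantics -/

/-- All qubit symbols in the type are active in the signature of length `n`. -/
def Ty.Wf (n : ℕ) : Ty → Prop
  | .qref q => q < n
  | .arr τ₁ τ₂ => τ₁.Wf n ∧ τ₂.Wf n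
  | .cmd τ => τ.Wf n
  | .prod _ τ => ∀ i, (τ i).Wf n
  | .bool => True
  | .unit => True

/-- Mobile types: their values mention no qubit symbol, so they may leave the scope of an
allocation. -/
def Ty.Mobile : Ty → Prop
  | .qref _ => False
  | .arr _ _ => False
  | .cmd _ => False
  | .prod _ τ => ∀ i, (τ i).Mobile
  | .bool => True
  | .unit => True

/-- `RefsTy τ k q`: the type `τ` is the type of references to the `k` qubits `q 0, …, q (k - 1)`.
A single reference counts as a tuple of length one. -/
inductive RefsTy : Ty → (k : ℕ) → (Fin k → ℕ) → Prop
  | tuple {k : ℕ} (q : Fin k → ℕ) : RefsTy (.prod k fun i => .qref (q i)) k q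
  | single (q : ℕ) : RefsTy (.qref q) 1 fun _ => q

mutual

/-- `ExpTy n Γ e τ`: in context `Γ`, relative to the signature of length `n`, the expression `e`
has type `τ`. -/
inductive ExpTy : ℕ → List Ty → Exp → Ty → Prop
  | var {n : ℕ} {Γ : List Ty} {x : ℕ} {τ : Ty} (h : Γ[x]? = some τ) : ExpTy n Γ (.var x) τ
  | letBe {n : ℕ} {Γ : List Ty} {e b : Exp} {τ₁ τ₂ : Ty} (he : ExpTy n Γ e τ₁)
      (hb : ExpTy n (τ₁ :: Γ) b τ₂) : ExpTy n Γ (.letBe e b) τ₂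
  | lam {n : ℕ} {Γ : List Ty} {b : Exp} {τ₁ τ₂ : Ty} (hτ : τ₁.Wf n)
      (hb : ExpTy n (τ₁ :: Γ) b τ₂) : ExpTy n Γ (.lam b) (.arr τ₁ τ₂)
  | app {n : ℕ} {Γ : List Ty} {e₁ e₂ : Exp} {τ₁ τ₂ : Ty} (h₁ : ExpTy n Γ e₁ (.arr τ₁ τ₂))
      (h₂ : ExpTy n Γ e₂ τ₁) : ExpTy n Γ (.app e₁ e₂) τ₂
  | cmd {n : ℕ} {Γ : List Ty} {m : Cmd} {τ : Ty} (h : CmdTy n Γ m τ) :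
      ExpTy n Γ (.cmd m) (.cmd τ)
  | tuple {n : ℕ} {Γ : List Ty} {k : ℕ} {es : Fin k → Exp} {τ : Fin k → Ty}
      (h : ∀ i, ExpTy n Γ (es i) (τ i)) : ExpTy n Γ (.tuple k es) (.prod k τ)
  | proj {n : ℕ} {Γ : List Ty} {k : ℕ} {e : Exp} {τ : Fin k → Ty} (h : ExpTy n Γ e (.prod k τ))
      (i : Fin k) : ExpTy n Γ (.proj e i) (τ i)
  | tt {n : ℕ} {Γ : List Ty} : ExpTy n Γ .tt .bool
  | ff {n : ℕ} {Γ : List Ty} : ExpTy n Γ .ff .bool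
  | ite {n : ℕ} {Γ : List Ty} {c e₁ e₂ : Exp} {τ : Ty} (hc : ExpTy n Γ c .bool)
      (h₁ : ExpTy n Γ e₁ τ) (h₂ : ExpTy n Γ e₂ τ) : ExpTy n Γ (.ite c e₁ e₂) τ
  | unit {n : ℕ} {Γ : List Ty} : ExpTy n Γ .unit .unit
  | qloc {n : ℕ} {Γ : List Ty} {q : ℕ} (hq : q < n) : ExpTy n Γ (.qloc q) (.qref q)

/-- `CmdTy n Γ m τ`: in context `Γ`, relative to the signature of length `n`, the command `m` is
well formed and returns a value of type `τ`. -/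
inductive CmdTy : ℕ → List Ty → Cmd → Ty → Prop
  | ret {n : ℕ} {Γ : List Ty} {e : Exp} {τ : Ty} (h : ExpTy n Γ e τ) : CmdTy n Γ (.ret e) τ
  | bnd {n : ℕ} {Γ : List Ty} {e : Exp} {m : Cmd} {τ τ' : Ty} (he : ExpTy n Γ e (.cmd τ))
      (hm : CmdTy n (τ :: Γ) m τ') : CmdTy n Γ (.bnd e m) τ'
  | new {n : ℕ} {Γ : List Ty} {m : Cmd} {τ : Ty} (hm : CmdTy (n + 1) (.qref n :: Γ) m τ)
      (hτ : τ.Mobile) : CmdTy n Γ (.new m) τ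
  | gate {n : ℕ} {Γ : List Ty} {k : ℕ} {U : Matrix.unitaryGroup (Bits k) ℂ} {e : Exp} {τ : Ty}
      {q : Fin k → ℕ} (he : ExpTy n Γ e τ) (hτ : RefsTy τ k q) (hq : ∀ i, q i < n)
      (hinj : Function.Injective q) : CmdTy n Γ (.gate k U e) .unit
  | diag {n : ℕ} {Γ : List Ty} {k : ℕ} {U V : Matrix.unitaryGroup (Bits k) ℂ} {e₁ e₂ : Exp}
      {τ : Ty} {c : ℕ} {q : Fin k → ℕ} (h₁ : ExpTy n Γ e₁ (.qref c)) (h₂ : ExpTy n Γ e₂ τ)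
      (hτ : RefsTy τ k q) (hc : c < n) (hq : ∀ i, q i < n) (hinj : Function.Injective q)
      (hcq : ∀ i, q i ≠ c) : CmdTy n Γ (.diag k U V e₁ e₂) .unit
  | meas {n : ℕ} {Γ : List Ty} {e : Exp} {q : ℕ} (he : ExpTy n Γ e (.qref q)) (hq : q < n) :
      CmdTy n Γ (.meas e) .bool

end

/-! ## Dynamic semantics -/

/-- Call-by-value evaluation of closed pure expressions to values. -/
inductive Exp.Eval : Exp → Exp → Prop
  | letBe {e b v w : Exp} (he : Exp.Eval e v) (hb : Exp.Eval (b.subst (single v)) w) :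
      Exp.Eval (.letBe e b) w
  | lam (b : Exp) : Exp.Eval (.lam b) (.lam b)
  | app {e₁ e₂ b v w : Exp} (h₁ : Exp.Eval e₁ (.lam b)) (h₂ : Exp.Eval e₂ v)
      (hb : Exp.Eval (b.subst (single v)) w) : Exp.Eval (.app e₁ e₂) w
  | cmd (m : Cmd) : Exp.Eval (.cmd m) (.cmd m)
  | tuple {k : ℕ} {es vs : Fin k → Exp} (h : ∀ i, Exp.Eval (es i) (vs i)) :
      Exp.Eval (.tuple k es) (.tuple k vs)
  | proj {k : ℕ} {e : Exp} {vs : Fin k → Exp} (h : Exp.Eval e (.tuple k vs)) (i : Fin k) :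
      Exp.Eval (.proj e i) (vs i)
  | tt : Exp.Eval .tt .tt
  | ff : Exp.Eval .ff .ff
  | iteTrue {c e₁ e₂ v : Exp} (hc : Exp.Eval c .tt) (h : Exp.Eval e₁ v) :
      Exp.Eval (.ite c e₁ e₂) v
  | iteFalse {c e₁ e₂ v : Exp} (hc : Exp.Eval c .ff) (h : Exp.Eval e₂ v) :
      Exp.Eval (.ite c e₁ e₂) v
  | unit : Exp.Eval .unit .unit
  | qloc (q : ℕ) : Exp.Eval (.qloc q) (.qloc q)

/-- `Refs v k q`: the value `v` is the tuple of references to the qubits `q 0, …, q (k - 1)`.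
A single reference counts as a tuple of length one. -/
inductive Refs : Exp → (k : ℕ) → (Fin k → ℕ) → Prop
  | tuple {k : ℕ} (q : Fin k → ℕ) : Refs (.tuple k fun i => .qloc (q i)) k q
  | single (q : ℕ) : Refs (.qloc q) 1 fun _ => q

/-- The operator on `n` qubits that acts as `A` on the `k` distinct qubits `q 0, …, q (k - 1)` and
as the identity on all others. -/
def onQubits {n k : ℕ} (A : Matrix (Bits k) (Bits k) ℂ) (q : Fin k → Fin n) :
    Matrix (Bits n) (Bits n) ℂ :=
  open Classical in
  Matrix.of fun x y =>
    if ∀ j, (∀ i, q i ≠ j) → x j = y j then A (fun i => x (q i)) (fun i => y (q i)) else 0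

/-- The block diagonal matrix `D(U, V) = U ⊕ V` on `k + 1` qubits, controlled by qubit `0`. -/
def blockDiag {k : ℕ} (U V : Matrix (Bits k) (Bits k) ℂ) :
    Matrix (Bits (k + 1)) (Bits (k + 1)) ℂ :=
  Matrix.of fun x y =>
    if x 0 = y 0 then (bif x 0 then V else U) (Fin.tail x) (Fin.tail y) else 0

/-- The projection onto the states of `n` qubits in which qubit `c` is `|b⟩`. -/
def measProj {n : ℕ} (c : Fin n) (b : Bool) : Matrix (Bits n) (Bits n) ℂ :=
  Matrix.diagonal fun x => if x c = b then 1 else 0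

/-- The isometry `ψ ↦ ψ ⊗ |b⟩` that adds one qubit, the last one. -/
def addQubit (n : ℕ) (b : Bool) : Matrix (Bits (n + 1)) (Bits n) ℂ :=
  Matrix.of fun x y => if x = Fin.snoc y b then 1 else 0

/-- A quantum instrument on `n` qubits with outcomes in `Exp`: a list of branches, each consisting
of the returned value and a Kraus operator on the store. -/
abbrev Instr (n : ℕ) : Type := List (Exp × Matrix (Bits n) (Bits n) ℂ)

/-- `Cmd.Eval n m L`: executing the closed command `m` on a store of `n` qubits has the branches
`L`: a branch `(v, K)` sends an (unnormalised) state `ρ` to `K ρ Kᴴ` and returns `v`.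
Allocation extends the store by a qubit in state `|0⟩`; at the end of its scope that qubit is
traced out. -/
inductive Cmd.Eval : (n : ℕ) → Cmd → Instr n → Prop
  | ret {n : ℕ} {e v : Exp} (he : e.Eval v) : Cmd.Eval n (.ret e) [(v, 1)]
  | bnd {n : ℕ} {e : Exp} {m₁ m₂ : Cmd} {L : Instr n} (F : Exp → Instr n)
      (he : e.Eval (.cmd m₁)) (h₁ : Cmd.Eval n m₁ L)
      (h₂ : ∀ b ∈ L, Cmd.Eval n (m₂.subst (single b.1)) (F b.1)) :
      Cmd.Eval n (.bnd e m₂) (L.flatMap fun b => (F b.1).map fun c => (c.1, c.2 * b.2))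
  | new {n : ℕ} {m : Cmd} {L : Instr (n + 1)}
      (h : Cmd.Eval (n + 1) (m.subst (single (.qloc n))) L) :
      Cmd.Eval n (.new m) (L.flatMap fun b =>
        [(b.1, (addQubit n false)ᴴ * b.2 * addQubit n false),
         (b.1, (addQubit n true)ᴴ * b.2 * addQubit n false)])
  | gate {n k : ℕ} {U : Matrix.unitaryGroup (Bits k) ℂ} {e v : Exp} {q : Fin k → Fin n}
      (he : e.Eval v) (hv : Refs v k fun i => q i) (hinj : Function.Injective q) :
      Cmd.Eval n (.gate k U e) [(.unit, onQubits U.1 q)]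
  | diag {n k : ℕ} {U V : Matrix.unitaryGroup (Bits k) ℂ} {e₁ e₂ v : Exp} {c : Fin n}
      {q : Fin k → Fin n} (h₁ : e₁.Eval (.qloc c)) (h₂ : e₂.Eval v) (hv : Refs v k fun i => q i)
      (hinj : Function.Injective q) (hcq : ∀ i, q i ≠ c) :
      Cmd.Eval n (.diag k U V e₁ e₂)
        [(.unit, onQubits (blockDiag U.1 V.1) (Fin.cons c q : Fin (k + 1) → Fin n))]
  | meas {n : ℕ} {e : Exp} {c : Fin n} (he : e.Eval (.qloc c)) :
      Cmd.Eval n (.meas e) [(.ff, measProj c false), (.tt, measProj c true)]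

/-- The action of an instrument in the Heisenberg picture: an observable for each returned value is
pulled back to an observable on the initial store. -/
def Instr.pullback {n : ℕ} (L : Instr n) (B : Exp → Matrix (Bits n) (Bits n) ℂ) :
    Matrix (Bits n) (Bits n) ℂ :=
  (L.map fun b => b.2ᴴ * B b.1 * b.2).sum

/-! ## Implementing maps on matrix algebras -/

/-- The algebra `M_{2^n}` of `2^n × 2^n` complex matrices, indexed by the computational basis. -/
abbrev MatAlg (n : ℕ) : Type := CStarMatrix (Bits n) (Bits n) ℂ

/-- The context `a₀ : qref q₀, …, a_{N-1} : qref q_{N-1}`. -/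
def qubitCtx (N : ℕ) : List Ty := List.ofFn fun i : Fin N => .qref i

/-- The type of results that report one out of `k` outcomes: a tuple of `k` booleans. -/
def outcomeTy (k : ℕ) : Ty := .prod k fun _ => .bool

/-- The result that reports outcome `i`: component `i` is true, all others are false. -/
def outcome {k : ℕ} (i : Fin k) : Exp := .tuple k fun j => if j = i then .tt else .ff

/-- The observable that measures `A i` on the first `d i` of `N` qubits if outcome `i` has been
reported. -/
noncomputable def outcomeObs {k N : ℕ} {d : Fin k → ℕ} (hd : ∀ i, d i ≤ N)
    (A : ∀ i, MatAlg (d i)) (v : Exp) : Matrix (Bits N) (Bits N) ℂ :=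
  open Classical in
  ∑ i, if v = outcome i then onQubits (CStarMatrix.ofMatrix.symm (A i)) (Fin.castLE (hd i)) else 0

/-- The command `m` over the references `a₀, …, a_{N-1}` implements
`f : M_{2^{d 0}} ⊕ ⋯ ⊕ M_{2^{d (k-1)}} → M_{2^p}`. The input is held by the first `p` qubits; `m`
reports an outcome `i` and leaves the output on the first `d i` qubits, all other qubits being
forgotten. The result does not depend on the initial state of the qubits beyond the first `p`. -/
def Implements {k N p : ℕ} {d : Fin k → ℕ} (hp : p ≤ N) (hd : ∀ i, d i ≤ N) (m : Cmd)
    (f : (∀ i, MatAlg (d i)) →CP MatAlg p) : Prop :=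
  ∃ L : Instr N, Cmd.Eval N (m.subst .qloc) L ∧
    ∀ A : ∀ i, MatAlg (d i), L.pullback (outcomeObs hd A) =
      onQubits (CStarMatrix.ofMatrix.symm (f A)) (Fin.castLE hp)

end LambdaQ

/-!
A completely positive unital map is an isometry followed by a measurement, and both are programs.

By Choi's argument (`exists_map_star_mul_eq_sum`), positivity of the matrix `[f (|a⟩⟨b|)]` for the
matrix units of each summand yields a factorization `star Y * Y`, and the rows of `Y ⊗ 1` are Kraus
operators: `f A ⊗ 1 = ∑ s, (L s)ᴴ * (A (o s) ⊗ 1) * L s`, where each `L s` is a square matrix on all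
`N` qubits whose range has the qubits beyond the first `d (o s)` in state `|0⟩` (`exists_kraus`).
The tensor factor `1` on the left makes the outcome independent of the qubits beyond the input.
Padding with zero operators, the index `s` becomes a string of `M` bits. As `f` is unital, the
operator `∑ s, |s⟩ ⊗ L s` is an isometry; it is `U (ψ ⊗ |0 ⋯ 0⟩)` for a unitary `U` on `N + M`
qubits, and measuring the `M` additional qubits applies `L s` with result `s`
(`exists_unitary_dilation`).

The program `dilationCmd` allocates the `M` additional qubits, applies `U`, measures the additional
qubits one by one, and returns `outcome (o s)`. Its execution is computed compositionally in the
Heisenberg picture: `Runs n m Φ` says that executing `m` pulls back observables by `Φ`, and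
`runs_bnd` and `runs_new` treat sequencing and allocation. Since programs are only ever executed
under environments of closed values, the one fact on substitution that is needed is
`Cmd.subst_liftSub_subst_single`.
-/

namespace LambdaQ

/-! ### Tensoring with the identity and with `|0⟩` -/

open scoped Kronecker

/-- On the first qubits of the store, `onQubits A` is the Kronecker product `A ⊗ 1`. -/
theorem onQubits_castAdd {p r : ℕ} (A : Matrix (Bits p) (Bits p) ℂ) :
    onQubits A (Fin.castAdd r) = (A ⊗ₖ (1 : Matrix (Bits r) (Bits r) ℂ)).submatrix
      (Fin.appendEquiv p r).symm (Fin.appendEquiv p r).symm := by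
  classical
  ext x y
  obtain ⟨⟨x₁, x₂⟩, rfl⟩ := (Fin.appendEquiv p r).surjective x
  obtain ⟨⟨y₁, y₂⟩, rfl⟩ := (Fin.appendEquiv p r).surjective y
  have h : (∀ j : Fin (p + r), (∀ i : Fin p, Fin.castAdd r i ≠ j) →
      Fin.append x₁ x₂ j = Fin.append y₁ y₂ j) ↔ x₂ = y₂ := by
    constructor
    · intro h
      funext j
      simpa using h (Fin.natAdd p j) fun i hi => by
        have := congrArg Fin.val hi
        simp at this
        omega
    · rintro rfl j hj
      induction j using Fin.addCases with
      | left i => exact absurd rfl (hj i)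
      | right i => simp
  simp only [onQubits, Matrix.of_apply, Matrix.submatrix_apply, Equiv.symm_apply_apply,
    Matrix.kroneckerMap_apply, Matrix.one_apply]
  simp only [Fin.appendEquiv, Equiv.coe_fn_mk, Fin.append_left, h]
  split_ifs <;> simp

theorem onQubits_castLE_mul {p N : ℕ} (h : p ≤ N) (A B : Matrix (Bits p) (Bits p) ℂ) :
    onQubits (A * B) (Fin.castLE h) = onQubits A (Fin.castLE h) * onQubits B (Fin.castLE h) := by
  obtain ⟨r, rfl⟩ := Nat.exists_eq_add_of_le h
  change onQubits _ (Fin.castAdd r) = onQubits _ (Fin.castAdd r) * onQubits _ (Fin.castAdd r)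
  rw [onQubits_castAdd, onQubits_castAdd, onQubits_castAdd, Matrix.submatrix_mul_equiv,
    ← Matrix.mul_kronecker_mul, Matrix.one_mul]

theorem onQubits_conjTranspose {n k : ℕ} (A : Matrix (Bits k) (Bits k) ℂ) (q : Fin k → Fin n) :
    onQubits Aᴴ q = (onQubits A q)ᴴ := by
  ext x y
  simp only [onQubits, Matrix.of_apply, Matrix.conjTranspose_apply, @eq_comm _ (x _) (y _)]
  split_ifs <;> simp

/-- `A ↦ onQubits A q` as a linear map. -/
def onQubitsₗ {n k : ℕ} (q : Fin k → Fin n) :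
    Matrix (Bits k) (Bits k) ℂ →ₗ[ℂ] Matrix (Bits n) (Bits n) ℂ where
  toFun A := onQubits A q
  map_add' A B := by
    ext x y
    simp only [onQubits, Matrix.of_apply, Matrix.add_apply]
    split_ifs <;> simp
  map_smul' c A := by
    ext x y
    simp only [onQubits, Matrix.of_apply, Matrix.smul_apply, RingHom.id_apply]
    split_ifs <;> simp

theorem onQubits_one {n k : ℕ} {q : Fin k → Fin n} :
    onQubits (1 : Matrix (Bits k) (Bits k) ℂ) q = 1 := by
  classical
  ext x y
  simp only [onQubits, Matrix.of_apply, Matrix.one_apply]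
  by_cases hxy : x = y
  · simp [hxy]
  · rw [if_neg hxy]
    split_ifs with h₁ h₂
    · refine absurd (funext fun j => ?_) hxy
      by_cases hj : ∃ i, q i = j
      · obtain ⟨i, rfl⟩ := hj
        exact congrFun h₂ i
      · exact h₁ j fun i hi => hj ⟨i, hi⟩
    · rfl
    · rfl

theorem onQubits_id {n : ℕ} (A : Matrix (Bits n) (Bits n) ℂ) : onQubits A id = A := by
  ext x y
  simp [onQubits]

/-- Extend a basis state of `d` qubits to one of `N` qubits by qubits in state `|0⟩`. Used for
`d ≤ N` only; for `N < d` it truncates. -/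
def pad (N : ℕ) {d : ℕ} (a : Bits d) : Bits N := fun j => if h : j < d then a ⟨j, h⟩ else false

theorem pad_injective {d N : ℕ} (h : d ≤ N) : Function.Injective (pad N : Bits d → Bits N) := by
  intro a b hab
  funext j
  simpa [pad] using congrFun hab (Fin.castLE h j)

theorem pad_pad {d n N : ℕ} (h : d ≤ n) (a : Bits d) : pad N (pad n a) = pad N a := by
  funext j
  simp only [pad]
  split_ifs <;> first | rfl | omega

/-- The isometry `ψ ↦ ψ ⊗ |0 ⋯ 0⟩` that extends the store from `d` to `N` qubits. -/
def padMat (N d : ℕ) : Matrix (Bits N) (Bits d) ℂ :=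
  Matrix.of fun x a => if x = pad N a then 1 else 0

theorem mul_padMat {N d : ℕ} {ι : Type*} (A : Matrix ι (Bits N) ℂ) :
    A * padMat N d = A.submatrix id (pad N) := by
  ext x a
  simp [padMat, Matrix.mul_apply]

theorem padMat_conjTranspose_mul {N d : ℕ} {ι : Type*} (A : Matrix (Bits N) ι ℂ) :
    (padMat N d)ᴴ * A = A.submatrix (pad N) id := by
  ext x a
  simp [padMat, Matrix.mul_apply]

theorem padMat_mul_padMat {N n d : ℕ} (h : d ≤ n) : padMat N n * padMat n d = padMat N d := by
  ext x a
  rw [mul_padMat]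
  simp [padMat, pad_pad h]

theorem padMat_self (n : ℕ) : padMat n n = 1 := by
  ext x a
  have : pad n a = a := by
    funext j
    simp [pad]
  simp [padMat, Matrix.one_apply, this]

theorem addQubit_false (n : ℕ) : addQubit n false = padMat (n + 1) n := by
  ext x a
  have : (Fin.snoc a false : Bits (n + 1)) = pad (n + 1) a := by
    funext j
    induction j using Fin.lastCases <;> simp [pad]
  simp [addQubit, padMat, this]

/-- Compressing `A ⊗ 1` to states in which the remaining qubits are `|0⟩` gives back `A`. -/
theorem padMat_conjTranspose_mul_onQubits_mul_padMat {N d : ℕ} (h : d ≤ N)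
    (A : Matrix (Bits d) (Bits d) ℂ) :
    (padMat N d)ᴴ * onQubits A (Fin.castLE h) * padMat N d = A := by
  ext x y
  rw [padMat_conjTranspose_mul, mul_padMat]
  simp only [Matrix.submatrix_apply, id, onQubits, Matrix.of_apply]
  rw [if_pos]
  · simp [pad]
  · intro j hj
    have : ¬ (j : ℕ) < d := fun h' => hj ⟨j, h'⟩ (Fin.ext rfl)
    simp [pad, this]

/-- Tracing out a qubit is, in the Heisenberg picture, tensoring the observable with the identity
on that qubit. -/
theorem sum_addQubit_mul_onQubits {d n : ℕ} (h : d ≤ n) (A : Matrix (Bits d) (Bits d) ℂ) :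
    ∑ b, addQubit n b * onQubits A (Fin.castLE h) * (addQubit n b)ᴴ =
      onQubits A (Fin.castLE (h.trans n.le_succ)) := by
  classical
  ext x y
  obtain ⟨⟨x₁, x₂⟩, rfl⟩ := (Fin.snocEquiv fun _ : Fin (n + 1) => Bool).surjective x
  obtain ⟨⟨y₁, y₂⟩, rfl⟩ := (Fin.snocEquiv fun _ : Fin (n + 1) => Bool).surjective y
  have h' : (∀ j : Fin (n + 1), (∀ i : Fin d, Fin.castLE (h.trans n.le_succ) i ≠ j) →
      (Fin.snoc x₂ x₁ : Bits (n + 1)) j = (Fin.snoc y₂ y₁ : Bits (n + 1)) j) ↔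
      x₁ = y₁ ∧ ∀ j : Fin n, (∀ i : Fin d, Fin.castLE h i ≠ j) → x₂ j = y₂ j := by
    rw [Fin.forall_fin_succ']
    constructor
    · rintro ⟨h₁, h₂⟩
      have hl : ∀ i : Fin d, Fin.castLE (h.trans n.le_succ) i ≠ Fin.last n := fun i hi => by
        have : (i : ℕ) = n := congrArg Fin.val hi
        omega
      exact ⟨by simpa using h₂ hl, fun j hj => by
        simpa using h₁ j fun i hi => hj i (by simpa [Fin.ext_iff] using hi)⟩
    · rintro ⟨rfl, h₂⟩
      exact ⟨fun j hj => by
        simpa using h₂ j fun i hi => hj i (by simpa [Fin.ext_iff] using hi), fun _ => by simp⟩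
  have hc : ∀ (z : Bits n) (c : Bool) (i : Fin d),
      (Fin.snoc z c : Bits (n + 1)) (Fin.castLE (h.trans n.le_succ) i) = z (Fin.castLE h i) :=
    fun z c i => Fin.snoc_castSucc (α := fun _ => Bool) c z (Fin.castLE h i)
  have hs : ∀ (z z' : Bits n) (c c' : Bool),
      (Fin.snoc z c : Bits (n + 1)) = Fin.snoc z' c' ↔ z = z' ∧ c = c' :=
    fun z z' c c' => Fin.snoc_inj (α := fun _ => Bool)
  simp only [Fin.snocEquiv, Equiv.coe_fn_mk, Matrix.sum_apply, Matrix.mul_apply, addQubit,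
    Matrix.of_apply, Matrix.conjTranspose_apply, hs]
  simp only [onQubits, Matrix.of_apply, h', hc]
  cases x₁ <;> cases y₁ <;> simp [ite_and]
  all_goals
    rw [Fintype.sum_eq_single x₂ fun z hz => by simp [hz.symm]]
    simp

/-! ### Joint measurement of the last qubits -/

/-- The projection onto the states in which each qubit `c j` is `|s j⟩`. -/
def jointProj {n M : ℕ} (c : Fin M → Fin n) (s : Bits M) : Matrix (Bits n) (Bits n) ℂ :=
  Matrix.diagonal fun x => if ∀ j, x (c j) = s j then 1 else 0

/-- The co-isometry `φ ⊗ |t⟩ ↦ ⟨s|t⟩ φ` that projects the last `M` qubits to `|s⟩` and drops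
them. -/
def dropMat (N : ℕ) {M : ℕ} (s : Bits M) : Matrix (Bits N) (Bits (N + M)) ℂ :=
  Matrix.of fun x w => if w = Fin.append x s then 1 else 0

theorem dropMat_mul {N M : ℕ} {ι : Type*} (s : Bits M) (A : Matrix (Bits (N + M)) ι ℂ) :
    dropMat N s * A = A.submatrix (fun x => Fin.append x s) id := by
  ext x a
  simp [dropMat, Matrix.mul_apply]

theorem mul_dropMat_conjTranspose {N M : ℕ} {ι : Type*} (s : Bits M)
    (A : Matrix ι (Bits (N + M)) ℂ) :
    A * (dropMat N s)ᴴ = A.submatrix id (fun x => Fin.append x s) := by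
  ext x a
  simp [dropMat, Matrix.mul_apply]

theorem append_eq_append {N M : ℕ} {x y : Bits N} {s t : Bits M} :
    Fin.append x s = Fin.append y t ↔ x = y ∧ s = t := by
  rw [← Prod.mk_inj]
  exact (Fin.appendEquiv N M).apply_eq_iff_eq (x := (x, s)) (y := (y, t))

theorem jointProj_natAdd {N M : ℕ} (s : Bits M) :
    jointProj (Fin.natAdd N) s = (dropMat N s)ᴴ * dropMat N s := by
  ext w w'
  obtain ⟨⟨x, t⟩, rfl⟩ := (Fin.appendEquiv N M).surjective w
  obtain ⟨⟨x', t'⟩, rfl⟩ := (Fin.appendEquiv N M).surjective w'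
  simp only [Fin.appendEquiv, Equiv.coe_fn_mk, jointProj, Matrix.diagonal_apply, Matrix.mul_apply,
    Matrix.conjTranspose_apply, dropMat, Matrix.of_apply, append_eq_append, Fin.append_right,
    ← funext_iff]
  rw [Fintype.sum_eq_single x fun z hz => by simp [hz.symm]]
  by_cases ht : t = s <;> by_cases ht' : t' = s <;> by_cases hx : x = x' <;>
    simp_all [eq_comm]

theorem dropMat_mul_onQubits_mul_conjTranspose {d N M : ℕ} (h : d ≤ N) (s : Bits M)
    (A : Matrix (Bits d) (Bits d) ℂ) :
    dropMat N s * onQubits A (Fin.castLE (h.trans (N.le_add_right M))) * (dropMat N s)ᴴ =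
      onQubits A (Fin.castLE h) := by
  classical
  ext x y
  rw [mul_dropMat_conjTranspose, dropMat_mul]
  have hc : ∀ (z : Bits N) (i : Fin d),
      Fin.append z s (Fin.castLE (h.trans (N.le_add_right M)) i) = z (Fin.castLE h i) :=
    fun z i => Fin.append_left z s (Fin.castLE h i)
  simp only [Matrix.submatrix_apply, id, onQubits, Matrix.of_apply, hc]
  refine if_congr ⟨fun h' j hj => ?_, fun h' j hj => ?_⟩ rfl rfl
  · simpa using h' (Fin.castAdd M j) fun i hi => hj i (by simpa [Fin.ext_iff] using hi)
  · induction j using Fin.addCases with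
    | left j => simpa using h' j fun i hi => hj i (by simpa [Fin.ext_iff] using hi)
    | right j => simp

/-- The operator `∑ s, |s⟩ ⊗ L s`, where `|s⟩` is a state of `M` additional qubits. -/
def stack {N M : ℕ} (L : Bits M → Matrix (Bits N) (Bits N) ℂ) :
    Matrix (Bits (N + M)) (Bits N) ℂ :=
  Matrix.of fun w y => L (fun j => w (Fin.natAdd N j)) (fun j => w (Fin.castAdd M j)) y

theorem dropMat_mul_stack {N M : ℕ} (L : Bits M → Matrix (Bits N) (Bits N) ℂ) (s : Bits M) :
    dropMat N s * stack L = L s := by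
  ext x y
  rw [dropMat_mul]
  simp [stack]

theorem sum_jointProj {n M : ℕ} (c : Fin M → Fin n) : ∑ s, jointProj c s = 1 := by
  ext x y
  simp [jointProj, Matrix.sum_apply, Matrix.diagonal_apply, Matrix.one_apply, ← funext_iff]

theorem stack_conjTranspose_mul_self {N M : ℕ} (L : Bits M → Matrix (Bits N) (Bits N) ℂ) :
    (stack L)ᴴ * stack L = ∑ s, (L s)ᴴ * L s := by
  conv_lhs => rw [← Matrix.mul_one (stack L)ᴴ, ← sum_jointProj (Fin.natAdd N), Matrix.mul_sum,
    Matrix.sum_mul]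
  refine Finset.sum_congr rfl fun s _ => ?_
  rw [jointProj_natAdd, ← Matrix.mul_assoc, Matrix.mul_assoc, dropMat_mul_stack,
    ← Matrix.conjTranspose_mul, dropMat_mul_stack]

/-- Measuring the last `M` qubits after applying `stack L` applies the Kraus operator `L s` when the
result is `s`. -/
theorem stack_conjTranspose_mul_jointProj {d N M : ℕ} (h : d ≤ N)
    (L : Bits M → Matrix (Bits N) (Bits N) ℂ) (s : Bits M) (A : Matrix (Bits d) (Bits d) ℂ) :
    (stack L)ᴴ * ((jointProj (Fin.natAdd N) s)ᴴ *
      onQubits A (Fin.castLE (h.trans (N.le_add_right M))) * jointProj (Fin.natAdd N) s) *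
        stack L = (L s)ᴴ * onQubits A (Fin.castLE h) * L s := by
  rw [jointProj_natAdd, Matrix.conjTranspose_mul, Matrix.conjTranspose_conjTranspose,
    ← dropMat_mul_onQubits_mul_conjTranspose h s, ← dropMat_mul_stack L s,
    Matrix.conjTranspose_mul]
  simp only [Matrix.mul_assoc]

/-! ### Extending an isometry to a unitary -/

/-- An isometry is a block of columns, in any prescribed position `e`, of a unitary matrix. -/
theorem exists_unitary_submatrix_eq {ι κ : Type*} [Fintype ι] [Fintype κ] [DecidableEq ι]
    [DecidableEq κ] {e : κ → ι} (he : Function.Injective e) {V : Matrix ι κ ℂ}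
    (hV : Vᴴ * V = 1) : ∃ U : Matrix.unitaryGroup ι ℂ, U.1.submatrix id e = V := by
  let v : ι → EuclideanSpace ℂ ι :=
    Function.extend e (fun y => WithLp.toLp 2 fun x => V x y) 0
  have hv : ∀ y, v (e y) = WithLp.toLp 2 fun x => V x y := fun y => he.extend_apply _ _ y
  have horth : Orthonormal ℂ ((Set.range e).domRestrict v) := by
    rw [orthonormal_iff_ite]
    rintro ⟨_, y, rfl⟩ ⟨_, z, rfl⟩
    have h := congrFun (congrFun hV y) z
    simp only [Matrix.mul_apply, Matrix.conjTranspose_apply, Matrix.one_apply] at h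
    simp only [Set.domRestrict_apply, hv, PiLp.inner_apply, RCLike.inner_apply]
    refine Eq.trans (Finset.sum_congr rfl fun x _ => mul_comm (V x z) _) (h.trans ?_)
    exact if_congr (by simp [Subtype.ext_iff, he.eq_iff]) rfl rfl
  -- The columns of `V`, at the positions `e y`, extend to an orthonormal basis indexed by `ι`.
  obtain ⟨b, hb⟩ := horth.exists_orthonormalBasis_extension_of_card_eq (by simp)
  refine ⟨⟨(EuclideanSpace.basisFun ι ℂ).toBasis.toMatrix b,
    (EuclideanSpace.basisFun ι ℂ).toMatrix_orthonormalBasis_mem_unitary b⟩, ?_⟩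
  ext x y
  simp [Module.Basis.toMatrix_apply, hb (e y) ⟨y, rfl⟩, hv]

/-! ### Kraus operators of a completely positive map -/

/-- Stated for an abstract C⋆-algebra, because the instances that the functional calculus requires
are not found on `CStarMatrix` directly. -/
theorem exists_eq_star_mul_self_of_nonneg {A : Type*} [CStarAlgebra A] [PartialOrder A]
    [StarOrderedRing A] {a : A} (h : 0 ≤ a) : ∃ b, a = star b * b :=
  CStarAlgebra.nonneg_iff_eq_star_mul_self.mp h

/-- Choi's argument: the matrix with entries `star (r a) * r b` is positive, hence so is its image
under `f`, and `Y` is a factor `star Y * Y` of the latter. -/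
theorem exists_map_star_mul_eq_sum {A B ι : Type*} [CStarAlgebra A] [PartialOrder A]
    [StarOrderedRing A] [CStarAlgebra B] [PartialOrder B] [StarOrderedRing B] [Fintype ι]
    [Inhabited ι] (f : A →CP B) (r : ι → A) :
    ∃ Y : ι → ι → B, ∀ a b, f (star (r a) * r b) = ∑ c, star (Y c a) * Y c b := by
  classical
  -- The matrix whose only nonzero row is `r`.
  let R : CStarMatrix ι ι A := CStarMatrix.ofMatrix fun c b => if c = default then r b else 0
  obtain ⟨Y, hY⟩ := exists_eq_star_mul_self_of_nonneg
    (CompletelyPositiveMap.map_cstarMatrix_nonneg f _ (star_mul_self_nonneg R))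
  refine ⟨fun c a => Y c a, fun a b => ?_⟩
  have h := congrFun (congrFun hY a) b
  have hRc : ∀ c b, R c b = if c = default then r b else 0 := fun _ _ => rfl
  have hR : (star R * R) a b = star (r a) * r b := by
    rw [CStarMatrix.mul_apply, Fintype.sum_eq_single default fun c hc => ?_]
    · simp [CStarMatrix.star_eq_conjTranspose, CStarMatrix.conjTranspose_apply, hRc]
    · simp [hRc, hc]
  rw [CStarMatrix.map_apply, hR] at h
  rw [h, CStarMatrix.mul_apply]
  simp [CStarMatrix.star_eq_conjTranspose, CStarMatrix.conjTranspose_apply]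

/-- The Kraus form of `A ↦ f A ⊗ 1`, where `f` is completely positive. Row `pad N a` of the Kraus
operator with index `(i, c, z)` is row `z` of the operator `Y i c a ⊗ 1`, where
`f (|a⟩⟨b|) = ∑ c, (Y i c a)ᴴ * Y i c b` on the `i`-th summand; all other rows vanish. -/
theorem exists_kraus {k p N : ℕ} {d : Fin k → ℕ} (f : (∀ i, MatAlg (d i)) →CP MatAlg p)
    (hp : p ≤ N) (hd : ∀ i, d i ≤ N) :
    ∃ L : (Σ i : Fin k, Bits (d i) × Bits N) → Matrix (Bits N) (Bits N) ℂ,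
      ∀ A : ∀ i, MatAlg (d i),
        ∑ s, (L s)ᴴ * onQubits (CStarMatrix.ofMatrix.symm (A s.1)) (Fin.castLE (hd s.1)) * L s =
          onQubits (CStarMatrix.ofMatrix.symm (f A)) (Fin.castLE hp) := by
  classical
  let E (i : Fin k) (a b : Bits (d i)) : MatAlg (d i) :=
    CStarMatrix.ofMatrix (Matrix.single a b (1 : ℂ))
  -- `|a⟩⟨b| = (|0⟩⟨a|)ᴴ * |0⟩⟨b|` brings the matrix units into the form of Choi's argument.
  have hE : ∀ i a b, (Pi.single i (E i a b) : ∀ i, MatAlg (d i)) =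
      star (Pi.single i (E i default a)) * Pi.single i (E i default b) := by
    intro i a b
    have : E i a b = star (E i default a) * E i default b := by
      have h : CStarMatrix.ofMatrix.symm (E i default a) = Matrix.single default a (1 : ℂ) := rfl
      have h' : CStarMatrix.ofMatrix.symm (E i default b) = Matrix.single default b (1 : ℂ) := rfl
      change _ = CStarMatrix.ofMatrix ((CStarMatrix.ofMatrix.symm (E i default a))ᴴ *
        CStarMatrix.ofMatrix.symm (E i default b))
      rw [h, h', Matrix.conjTranspose_single, Matrix.single_mul_single_same, star_one, one_mul]
    rw [this, ← Pi.single_star, ← Pi.single_mul]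
  choose Y hY using fun i =>
    exists_map_star_mul_eq_sum f fun a : Bits (d i) => Pi.single i (E i default a)
  let Z (i : Fin k) (c a : Bits (d i)) : Matrix (Bits N) (Bits N) ℂ :=
    onQubits (CStarMatrix.ofMatrix.symm (Y i c a)) (Fin.castLE hp)
  let K (s : Σ i : Fin k, Bits (d i) × Bits N) : Matrix (Bits (d s.1)) (Bits N) ℂ :=
    Matrix.of fun a y => Z s.1 s.2.1 a s.2.2 y
  -- It suffices to compare both sides, which are linear in `A`, on matrix units.
  let F : (∀ i, MatAlg (d i)) →ₗ[ℂ] Matrix (Bits N) (Bits N) ℂ :=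
    onQubitsₗ (Fin.castLE hp) ∘ₗ CStarMatrix.ofMatrixₗ.symm.toLinearMap ∘ₗ f.toLinearMap
  have hF : ∀ i a b, F (Pi.single i (E i a b)) = ∑ c, (Z i c a)ᴴ * Z i c b := by
    intro i a b
    change onQubitsₗ (Fin.castLE hp) (CStarMatrix.ofMatrixₗ.symm (f (Pi.single i (E i a b)))) = _
    rw [hE, hY, map_sum, map_sum]
    refine Finset.sum_congr rfl fun c _ => ?_
    change onQubits ((CStarMatrix.ofMatrix.symm (Y i c a))ᴴ * CStarMatrix.ofMatrix.symm (Y i c b)) _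
      = _
    rw [onQubits_castLE_mul, onQubits_conjTranspose]
  have hA : ∀ A : ∀ i, MatAlg (d i), A = ∑ i, ∑ a, ∑ b, A i a b • Pi.single i (E i a b) := by
    intro A
    conv_lhs => rw [← Finset.univ_sum_single A]
    refine Finset.sum_congr rfl fun i _ => ?_
    have : A i = ∑ a, ∑ b, A i a b • E i a b := by
      refine (Matrix.matrix_eq_sum_single (CStarMatrix.ofMatrix.symm (A i))).trans ?_
      refine Finset.sum_congr rfl fun a _ => Finset.sum_congr rfl fun b _ => ?_
      change _ = A i a b • Matrix.single a b (1 : ℂ)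
      rw [Matrix.smul_single, smul_eq_mul, mul_one]
      rfl
    conv_lhs => rw [this]
    change LinearMap.single ℂ _ i _ = _
    simp only [map_sum, map_smul]
    rfl
  refine ⟨fun s => padMat N (d s.1) * K s, fun A => ?_⟩
  change _ = F A
  conv_rhs => rw [hA A]
  simp only [map_sum, map_smul, hF]
  rw [Fintype.sum_sigma]
  refine Finset.sum_congr rfl fun i _ => ?_
  -- The qubits that the Kraus operators set to `|0⟩` drop out of the expectation of `A i ⊗ 1`.
  have hK : ∀ s : Bits (d i) × Bits N,
      (padMat N (d i) * K ⟨i, s⟩)ᴴ *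
        onQubits (CStarMatrix.ofMatrix.symm (A i)) (Fin.castLE (hd i)) *
          (padMat N (d i) * K ⟨i, s⟩) =
      (K ⟨i, s⟩)ᴴ * CStarMatrix.ofMatrix.symm (A i) * K ⟨i, s⟩ := by
    intro s
    conv_rhs => rw [← padMat_conjTranspose_mul_onQubits_mul_padMat (hd i)
      (CStarMatrix.ofMatrix.symm (A i))]
    rw [Matrix.conjTranspose_mul]
    simp only [Matrix.mul_assoc]
  simp only [hK]
  ext x y
  rw [Fintype.sum_prod_type]
  simp only [Matrix.sum_apply, Matrix.smul_apply, Matrix.mul_apply, Matrix.conjTranspose_apply, K,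
    Matrix.of_apply, smul_eq_mul, Finset.mul_sum, Finset.sum_mul, CStarMatrix.ofMatrix_symm_apply]
  conv_rhs =>
    enter [2, a]
    rw [Finset.sum_comm]
  conv_rhs => rw [Finset.sum_comm]
  refine Finset.sum_congr rfl fun c _ => ?_
  conv_rhs => rw [Finset.sum_comm]
  rw [Finset.sum_comm]
  refine Finset.sum_congr rfl fun b _ => ?_
  rw [Finset.sum_comm]
  refine Finset.sum_congr rfl fun a _ => Finset.sum_congr rfl fun z _ => ?_
  ring

/-! ### Unitary dilation -/

/-- A unital completely positive map amounts to measuring the last `M` qubits after applying a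
unitary to the input and `M` further qubits in state `|0⟩`, each result being read as an outcome. -/
theorem exists_unitary_dilation {k p N : ℕ} {d : Fin k → ℕ}
    (f : (∀ i, MatAlg (d i)) →CP MatAlg p) (hf : f 1 = 1) (hp : p ≤ N) (hd : ∀ i, d i ≤ N) :
    ∃ (M : ℕ) (o : Bits M → Fin k) (U : Matrix.unitaryGroup (Bits (N + M)) ℂ),
      ∀ A : ∀ i, MatAlg (d i),
        (padMat (N + M) N)ᴴ * (U.1ᴴ * (∑ s, (jointProj (Fin.natAdd N) s)ᴴ *
          onQubits (CStarMatrix.ofMatrix.symm (A (o s)))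
            (Fin.castLE ((hd (o s)).trans (N.le_add_right M))) *
          jointProj (Fin.natAdd N) s) * U.1) * padMat (N + M) N =
        onQubits (CStarMatrix.ofMatrix.symm (f A)) (Fin.castLE hp) := by
  classical
  -- Without outcomes `f` would vanish, but `f 1 = 1`.
  have i₀ : Nonempty (Fin k) := by
    by_contra h
    rw [not_nonempty_iff] at h
    have h₁ : (1 : ∀ i, MatAlg (d i)) = 0 := Subsingleton.elim _ _
    rw [h₁, map_zero] at hf
    exact zero_ne_one hf
  obtain ⟨L, hL⟩ := exists_kraus f hp hd
  obtain ⟨M, ⟨e⟩⟩ : ∃ M, Nonempty ((Σ i : Fin k, Bits (d i) × Bits N) ↪ Bits M) := by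
    refine ⟨Fintype.card (Σ i : Fin k, Bits (d i) × Bits N),
      Function.Embedding.nonempty_of_card_le ?_⟩
    rw [Fintype.card_fun, Fintype.card_bool, Fintype.card_fin]
    exact Nat.lt_two_pow_self.le
  -- Results outside the range of `e` have Kraus operator `0`, so their outcome is irrelevant.
  let L' : Bits M → Matrix (Bits N) (Bits N) ℂ := Function.extend e L 0
  let o : Bits M → Fin k := Function.extend e Sigma.fst fun _ => i₀.some
  have hL' : ∀ A : ∀ i, MatAlg (d i),
      ∑ s, (L' s)ᴴ * onQubits (CStarMatrix.ofMatrix.symm (A (o s))) (Fin.castLE (hd (o s))) * L' s =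
        onQubits (CStarMatrix.ofMatrix.symm (f A)) (Fin.castLE hp) := by
    intro A
    rw [← hL A]
    refine (Fintype.sum_of_injective e e.injective _ _ (fun s hs => ?_) fun t => ?_).symm
    · have : L' s = 0 := Function.extend_apply' _ _ _ hs
      rw [this, Matrix.mul_zero]
    · have h₁ : L' (e t) = L t := e.injective.extend_apply _ _ t
      have h₂ : o (e t) = t.1 := e.injective.extend_apply _ _ t
      rw [h₁]
      congr! 2
      rw [h₂]
  have hV : (stack L')ᴴ * stack L' = 1 := by
    rw [stack_conjTranspose_mul_self]
    have h := hL' 1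
    have h₁ : ∀ n, CStarMatrix.ofMatrix.symm (1 : MatAlg n) = 1 := fun _ => rfl
    simpa only [hf, Pi.one_apply, h₁, onQubits_one, Matrix.mul_one] using h
  obtain ⟨U, hU⟩ := exists_unitary_submatrix_eq (pad_injective (N.le_add_right M)) hV
  rw [← mul_padMat] at hU
  refine ⟨M, o, U, fun A => ?_⟩
  rw [← hL' A]
  have h : ∀ X : Matrix (Bits (N + M)) (Bits (N + M)) ℂ,
      (padMat (N + M) N)ᴴ * (U.1ᴴ * X * U.1) * padMat (N + M) N =
        (stack L')ᴴ * X * stack L' := by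
    intro X
    rw [← hU, Matrix.conjTranspose_mul]
    simp only [Matrix.mul_assoc]
  rw [h, Matrix.mul_sum, Matrix.sum_mul]
  exact Finset.sum_congr rfl fun s _ =>
    stack_conjTranspose_mul_jointProj (hd (o s)) L' s _

/-! ### Substitution of closed values -/

/-- `e` has no free variables, expressed as invariance under renaming and substitution. -/
def Exp.Closed (e : Exp) : Prop := (∀ ξ, e.rename ξ = e) ∧ ∀ σ, e.subst σ = e

/-- A condition under which substituting by `σ`, then by `τ`, amounts to substituting by `ρ`: each
`σ x` is a variable, which `τ` sends to `ρ x`, or closed. Unlike the bare equation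
`(σ x).subst τ = ρ x`, it is preserved by `liftSub` without further substitution lemmas. -/
def SubComp (σ τ ρ : ℕ → Exp) : Prop :=
  ∀ x, (∃ y, σ x = .var y ∧ τ y = ρ x) ∨ ((σ x).Closed ∧ ρ x = σ x)

theorem SubComp.lift {σ τ ρ : ℕ → Exp} (h : SubComp σ τ ρ) :
    SubComp (liftSub σ) (liftSub τ) (liftSub ρ)
  | 0 => .inl ⟨0, rfl, rfl⟩
  | x + 1 => by
    obtain ⟨y, h₁, h₂⟩ | ⟨h₁, h₂⟩ := h x
    · exact .inl ⟨y + 1, by simp [liftSub, h₁, Exp.rename], by simp [liftSub, h₂]⟩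
    · right
      simpa only [liftSub, h₂, h₁.1, and_true] using h₁

mutual

theorem Exp.subst_subst : ∀ (e : Exp) {σ τ ρ : ℕ → Exp}, SubComp σ τ ρ →
    (e.subst σ).subst τ = e.subst ρ
  | .var x, σ, τ, ρ, h => by
    obtain ⟨y, h₁, h₂⟩ | ⟨h₁, h₂⟩ := h x
    · simp [Exp.subst, h₁, h₂]
    · simp [Exp.subst, h₂, h₁.2]
  | .letBe e b, _, _, _, h => by simp only [Exp.subst, e.subst_subst h, b.subst_subst h.lift]
  | .lam b, _, _, _, h => by simp only [Exp.subst, b.subst_subst h.lift]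
  | .app e₁ e₂, _, _, _, h => by simp only [Exp.subst, e₁.subst_subst h, e₂.subst_subst h]
  | .cmd m, _, _, _, h => by simp only [Exp.subst, m.subst_subst h]
  | .tuple _ es, _, _, _, h => by simp only [Exp.subst, fun i => (es i).subst_subst h]
  | .proj e _, _, _, _, h => by simp only [Exp.subst, e.subst_subst h]
  | .tt, _, _, _, _ => by simp only [Exp.subst]
  | .ff, _, _, _, _ => by simp only [Exp.subst]
  | .ite c e₁ e₂, _, _, _, h => by
    simp only [Exp.subst, c.subst_subst h, e₁.subst_subst h, e₂.subst_subst h]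
  | .unit, _, _, _, _ => by simp only [Exp.subst]
  | .qloc _, _, _, _, _ => by simp only [Exp.subst]

theorem Cmd.subst_subst : ∀ (m : Cmd) {σ τ ρ : ℕ → Exp}, SubComp σ τ ρ →
    (m.subst σ).subst τ = m.subst ρ
  | .ret e, _, _, _, h => by simp only [Cmd.subst, e.subst_subst h]
  | .bnd e m, _, _, _, h => by simp only [Cmd.subst, e.subst_subst h, m.subst_subst h.lift]
  | .new m, _, _, _, h => by simp only [Cmd.subst, m.subst_subst h.lift]
  | .gate _ _ e, _, _, _, h => by simp only [Cmd.subst, e.subst_subst h]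
  | .diag _ _ _ e₁ e₂, _, _, _, h => by
    simp only [Cmd.subst, e₁.subst_subst h, e₂.subst_subst h]
  | .meas e, _, _, _, h => by simp only [Cmd.subst, e.subst_subst h]

end

/-- Extend an environment by a value for the variable bound last. -/
def extendEnv (v : Exp) (σ : ℕ → Exp) : ℕ → Exp
  | 0 => v
  | x + 1 => σ x

theorem Exp.closed_qloc (q : ℕ) : (Exp.qloc q).Closed :=
  ⟨fun _ => by simp only [Exp.rename], fun _ => by simp only [Exp.subst]⟩

theorem Exp.closed_tt : Exp.tt.Closed :=
  ⟨fun _ => by simp only [Exp.rename], fun _ => by simp only [Exp.subst]⟩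

theorem Exp.closed_ff : Exp.ff.Closed :=
  ⟨fun _ => by simp only [Exp.rename], fun _ => by simp only [Exp.subst]⟩

theorem Exp.closed_unit : Exp.unit.Closed :=
  ⟨fun _ => by simp only [Exp.rename], fun _ => by simp only [Exp.subst]⟩

theorem closed_extendEnv {v : Exp} {σ : ℕ → Exp} (hv : v.Closed) (hσ : ∀ x, (σ x).Closed) :
    ∀ x, (extendEnv v σ x).Closed
  | 0 => hv
  | x + 1 => hσ x

/-- Binding a variable under an environment of closed values extends the environment. -/
theorem Cmd.subst_liftSub_subst_single {σ : ℕ → Exp} (hσ : ∀ x, (σ x).Closed) (m : Cmd)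
    (v : Exp) : (m.subst (liftSub σ)).subst (single v) = m.subst (extendEnv v σ) := by
  refine m.subst_subst fun x => ?_
  cases x with
  | zero => exact .inl ⟨0, rfl, rfl⟩
  | succ x =>
    have h : liftSub σ (x + 1) = σ x := (hσ x).1 _
    exact .inr ⟨h.symm ▸ hσ x, h.symm⟩

/-! ### Compositional description of executions -/

/-- Executing `m` on `n` qubits returns values only, and its branches have the pullback `Φ`. -/
def Runs (n : ℕ) (m : Cmd)
    (Φ : (Exp → Matrix (Bits n) (Bits n) ℂ) → Matrix (Bits n) (Bits n) ℂ) : Prop :=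
  ∃ L : Instr n, Cmd.Eval n m L ∧ (∀ b ∈ L, b.1.Eval b.1) ∧ ∀ B, L.pullback B = Φ B

theorem pullback_flatMap_mul {n : ℕ} (L : Instr n) (F : Exp → Instr n)
    (B : Exp → Matrix (Bits n) (Bits n) ℂ) :
    Instr.pullback (L.flatMap fun b => (F b.1).map fun c => (c.1, c.2 * b.2)) B =
      L.pullback fun v => (F v).pullback B := by
  have h : ∀ (K : Instr n) (X : Matrix (Bits n) (Bits n) ℂ),
      Instr.pullback (K.map fun c => (c.1, c.2 * X)) B = Xᴴ * K.pullback B * X := by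
    intro K X
    induction K with
    | nil => simp [Instr.pullback]
    | cons c K ih =>
      simp only [Instr.pullback, List.map_cons, List.sum_cons] at ih ⊢
      rw [ih, Matrix.mul_add, Matrix.add_mul, Matrix.conjTranspose_mul]
      simp only [Matrix.mul_assoc]
  induction L with
  | nil => simp [Instr.pullback]
  | cons b L ih =>
    have h' := h (F b.1) b.2
    simp only [Instr.pullback, List.flatMap_cons, List.map_append, List.sum_append,
      List.map_cons, List.sum_cons] at ih h' ⊢
    rw [ih, h']

theorem pullback_congr {n : ℕ} {L : Instr n} {B B' : Exp → Matrix (Bits n) (Bits n) ℂ}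
    (h : ∀ b ∈ L, B b.1 = B' b.1) : L.pullback B = L.pullback B' := by
  unfold Instr.pullback
  congr 1
  exact List.map_congr_left fun b hb => by rw [h b hb]

theorem runs_bnd {n : ℕ} {e : Exp} {m₁ m₂ : Cmd} {L : Instr n}
    {Ψ : Exp → (Exp → Matrix (Bits n) (Bits n) ℂ) → Matrix (Bits n) (Bits n) ℂ}
    (he : e.Eval (.cmd m₁)) (h₁ : Cmd.Eval n m₁ L)
    (h₂ : ∀ b ∈ L, Runs n (m₂.subst (single b.1)) (Ψ b.1)) :
    Runs n (.bnd e m₂) fun B => L.pullback fun v => Ψ v B := by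
  have h : ∀ v, ∃ K : Instr n, (∃ b ∈ L, b.1 = v) → Cmd.Eval n (m₂.subst (single v)) K ∧
      (∀ b ∈ K, b.1.Eval b.1) ∧ ∀ B, K.pullback B = Ψ v B := by
    intro v
    by_cases hv : ∃ b ∈ L, b.1 = v
    · obtain ⟨b, hb, rfl⟩ := hv
      obtain ⟨K, hK⟩ := h₂ b hb
      exact ⟨K, fun _ => hK⟩
    · exact ⟨[], fun hv' => absurd hv' hv⟩
  choose F hF using h
  refine ⟨_, .bnd F he h₁ fun b hb => (hF b.1 ⟨b, hb, rfl⟩).1, fun c hc => ?_, fun B => ?_⟩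
  · obtain ⟨b, hb, hc⟩ := List.mem_flatMap.1 hc
    obtain ⟨c', hc', rfl⟩ := List.mem_map.1 hc
    exact (hF b.1 ⟨b, hb, rfl⟩).2.1 c' hc'
  · rw [pullback_flatMap_mul]
    exact pullback_congr fun b hb => (hF b.1 ⟨b, hb, rfl⟩).2.2 B

theorem runs_bnd_ret_var {n : ℕ} {e : Exp} {m : Cmd}
    {Φ : (Exp → Matrix (Bits n) (Bits n) ℂ) → Matrix (Bits n) (Bits n) ℂ}
    (he : e.Eval (.cmd m)) (h : Runs n m Φ) : Runs n (.bnd e (.ret (.var 0))) Φ := by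
  obtain ⟨L, hL, hv, hΦ⟩ := h
  have := runs_bnd (Ψ := fun v B => B v) (m₂ := .ret (.var 0)) he hL fun b hb =>
    ⟨[(b.1, 1)], by simpa [Cmd.subst, Exp.subst, single] using .ret (hv b hb),
      by simpa using hv b hb, fun B => by simp [Instr.pullback]⟩
  rwa [← funext hΦ]

/-- Allocation prepares `|0⟩` before, and traces out the qubit after, the execution of `m`. -/
theorem runs_new {n : ℕ} {m : Cmd}
    {Φ : (Exp → Matrix (Bits (n + 1)) (Bits (n + 1)) ℂ) → Matrix (Bits (n + 1)) (Bits (n + 1)) ℂ}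
    (h : Runs (n + 1) (m.subst (single (.qloc n))) Φ) :
    Runs n (.new m) fun B => (padMat (n + 1) n)ᴴ *
      Φ (fun v => ∑ t, addQubit n t * B v * (addQubit n t)ᴴ) * padMat (n + 1) n := by
  obtain ⟨L, hL, hv, hΦ⟩ := h
  refine ⟨_, .new hL, fun c hc => ?_, fun B => ?_⟩
  · obtain ⟨b, hb, hc⟩ := List.mem_flatMap.1 hc
    have : c.1 = b.1 := by
      rcases List.mem_pair.1 hc with rfl | rfl <;> rfl
    exact this ▸ hv b hb
  · simp only [← hΦ, ← addQubit_false]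
    clear hL hv hΦ
    induction L with
    | nil => simp [Instr.pullback]
    | cons b L ih =>
      simp only [Instr.pullback, List.flatMap_cons, List.map_append, List.sum_append,
        List.map_cons, List.sum_cons, List.map_nil, List.sum_nil, add_zero] at ih ⊢
      rw [ih]
      simp only [Matrix.mul_add, Matrix.add_mul, Matrix.conjTranspose_mul, Fintype.sum_bool,
        Matrix.conjTranspose_conjTranspose, Matrix.mul_assoc]
      abel

/-! ### Adaptive measurement -/

/-- Measure the qubits referred to by the variables `v 0, …, v (M - 1)` and return `outcome (o s)`,
where `s` are the results. Each measurement is followed by a conditional on its result, so that the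
leaves of the resulting decision tree are constant and `o` need not be computed by an expression. -/
def measTree {k : ℕ} : {M : ℕ} → (Fin M → ℕ) → (Bits M → Fin k) → Cmd
  | 0, _, o => .ret (outcome (o Fin.elim0))
  | _ + 1, v, o => .bnd (.cmd (.meas (.var (v 0)))) <| .bnd
      (.ite (.var 0) (.cmd (measTree (fun j => v j.succ + 1) fun s => o (Fin.cons true s)))
        (.cmd (measTree (fun j => v j.succ + 1) fun s => o (Fin.cons false s))))
      (.ret (.var 0))

theorem outcome_subst {k : ℕ} (i : Fin k) (σ : ℕ → Exp) : (outcome i).subst σ = outcome i := by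
  simp only [outcome, Exp.subst]
  congr 1
  funext j
  split_ifs <;> simp only [Exp.subst]

theorem outcome_eval {k : ℕ} (i : Fin k) : (outcome i).Eval (outcome i) := by
  refine .tuple fun j => ?_
  split_ifs
  exacts [.tt, .ff]

theorem outcome_source {k : ℕ} (i : Fin k) : (outcome i).Source := by
  simp only [outcome, Exp.Source]
  intro j
  split_ifs <;> simp only [Exp.Source]

theorem outcome_typed {k : ℕ} (i : Fin k) (n : ℕ) (Γ : List Ty) :
    ExpTy n Γ (outcome i) (outcomeTy k) := by
  refine .tuple fun j => ?_
  split_ifs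
  exacts [.tt, .ff]

theorem outcome_injective {k : ℕ} : Function.Injective (outcome (k := k)) := by
  intro i j h
  by_contra hij
  have h' := congrFun (eq_of_heq (Exp.tuple.inj h).2) i
  simp [hij] at h'

theorem measTree_source {k M : ℕ} (v : Fin M → ℕ) (o : Bits M → Fin k) :
    (measTree v o).Source := by
  induction M with
  | zero => simpa only [measTree, Cmd.Source] using outcome_source _
  | succ M ih => simp only [measTree, Cmd.Source, Exp.Source, ih, and_self]

theorem measTree_typed {k n M : ℕ} {Γ : List Ty} {v : Fin M → ℕ} {c : Fin M → Fin n}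
    (hv : ∀ j, Γ[v j]? = some (.qref (c j))) (o : Bits M → Fin k) :
    CmdTy n Γ (measTree v o) (outcomeTy k) := by
  induction M generalizing Γ with
  | zero => exact .ret (outcome_typed _ _ _)
  | succ M ih =>
    have h : ∀ o' : Bits M → Fin k,
        ExpTy n (.bool :: Γ) (.cmd (measTree (fun j => v j.succ + 1) o')) (.cmd (outcomeTy k)) :=
      fun o' => .cmd (ih (c := fun j => c j.succ) (fun j => by simpa using hv j.succ) o')
    exact .bnd (.cmd (.meas (.var (hv 0)) (c 0).2))
      (.bnd (.ite (.var rfl) (h _) (h _)) (.ret (.var rfl)))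

theorem jointProj_cons {n M : ℕ} (c : Fin (M + 1) → Fin n) (b : Bool) (s : Bits M) :
    jointProj c (Fin.cons b s : Bits (M + 1)) =
      jointProj (fun j => c j.succ) s * measProj (c 0) b := by
  simp only [jointProj, measProj, Matrix.diagonal_mul_diagonal, Fin.forall_fin_succ,
    Fin.cons_zero, Fin.cons_succ]
  congr 1
  funext x
  by_cases h₁ : x (c 0) = b <;> by_cases h₂ : ∀ j : Fin M, x (c j.succ) = s j <;> simp [h₁, h₂]

theorem measTree_runs {k n M : ℕ} {σ : ℕ → Exp} (hσ : ∀ x, (σ x).Closed) {v : Fin M → ℕ}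
    {c : Fin M → Fin n} (hv : ∀ j, σ (v j) = .qloc (c j)) (o : Bits M → Fin k) :
    Runs n ((measTree v o).subst σ) fun B =>
      ∑ s, (jointProj c s)ᴴ * B (outcome (o s)) * jointProj c s := by
  induction M generalizing σ with
  | zero =>
    refine ⟨[(outcome (o Fin.elim0), 1)], ?_, by simpa using outcome_eval _, fun B => ?_⟩
    · simp only [measTree, Cmd.subst, outcome_subst]
      exact .ret (outcome_eval _)
    · have h : ∀ s, jointProj c s = 1 := fun s => by simp [jointProj]
      beta_reduce
      rw [Fintype.sum_subsingleton _ (Fin.elim0 : Bits 0), h]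
      simp [Instr.pullback]
  | succ M ih =>
    let Ψ (b : Bool) (B : Exp → Matrix (Bits n) (Bits n) ℂ) : Matrix (Bits n) (Bits n) ℂ :=
      ∑ s, (jointProj (fun j => c j.succ) s)ᴴ * B (outcome (o (Fin.cons b s))) *
        jointProj (fun j => c j.succ) s
    -- The result of the first measurement, decoded from the value returned.
    let val (e : Exp) : Bool := match e with
      | .tt => true
      | _ => false
    have hb : ∀ w : Exp, w.Closed → ∀ b, Runs n ((measTree (fun j => v j.succ + 1) fun s =>
        o (Fin.cons b s)).subst (extendEnv w σ)) (Ψ b) := fun w hw b =>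
      ih (v := fun j => v j.succ + 1) (c := fun j => c j.succ) (closed_extendEnv hw hσ)
        (fun j => hv j.succ) fun s => o (Fin.cons b s)
    simp only [measTree, Cmd.subst, Exp.subst, hv]
    have := runs_bnd (n := n) (Ψ := fun e => Ψ (val e)) (m₂ := (Cmd.bnd
      (.ite (.var 0) (.cmd (measTree (fun j => v j.succ + 1) fun s => o (Fin.cons true s)))
        (.cmd (measTree (fun j => v j.succ + 1) fun s => o (Fin.cons false s))))
      (.ret (.var 0))).subst (liftSub σ)) (.cmd _) (.meas (.qloc (c 0))) ?_
    · simp only [Cmd.subst, Exp.subst] at this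
      convert this using 2 with B
      simp only [Instr.pullback, List.map_cons, List.map_nil, List.sum_cons, List.sum_nil, add_zero,
        val, Ψ]
      rw [← (Fin.consEquiv fun _ : Fin (M + 1) => Bool).sum_comp, Fintype.sum_prod_type,
        Fintype.sum_bool, add_comm]
      simp only [Fin.consEquiv, Equiv.coe_fn_mk, jointProj_cons, Matrix.mul_sum, Matrix.sum_mul,
        Matrix.conjTranspose_mul, Matrix.mul_assoc]
    · intro b hbL
      rw [Cmd.subst_liftSub_subst_single hσ]
      simp only [Cmd.subst, Exp.subst]
      rcases List.mem_pair.1 hbL with rfl | rfl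
      · exact runs_bnd_ret_var (.iteFalse .ff (.cmd _)) (hb _ Exp.closed_ff false)
      · exact runs_bnd_ret_var (.iteTrue .tt (.cmd _)) (hb _ Exp.closed_tt true)

/-! ### Allocation of several qubits -/

/-- Run `m` with `M` additional qubits, which `m` refers to by its variables `0, …, M - 1`, starting
with the qubit allocated last. -/
def alloc : ℕ → Cmd → Cmd
  | 0, m => m
  | M + 1, m => alloc M (.new m)

/-- The environment inside `M` allocations on top of `n` qubits. -/
def allocEnv (n : ℕ) (σ : ℕ → Exp) : ℕ → ℕ → Exp
  | 0 => σ
  | M + 1 => extendEnv (.qloc (n + M)) (allocEnv n σ M)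

/-- The context inside `M` allocations on top of `n` qubits. -/
def allocCtx (n : ℕ) (Γ : List Ty) : ℕ → List Ty
  | 0 => Γ
  | M + 1 => .qref (n + M) :: allocCtx n Γ M

/-- `B ⊗ 1`, where `1` acts on `M` additional qubits. -/
noncomputable def extendObs {n : ℕ} (B : Matrix (Bits n) (Bits n) ℂ) :
    (M : ℕ) → Matrix (Bits (n + M)) (Bits (n + M)) ℂ
  | 0 => B
  | M + 1 => ∑ t, addQubit (n + M) t * extendObs B M * (addQubit (n + M) t)ᴴ

theorem extendObs_onQubits {d n : ℕ} (h : d ≤ n) (A : Matrix (Bits d) (Bits d) ℂ) (M : ℕ) :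
    extendObs (onQubits A (Fin.castLE h)) M =
      onQubits A (Fin.castLE (h.trans (n.le_add_right M))) := by
  induction M with
  | zero => rfl
  | succ M ih => rw [extendObs, ih, sum_addQubit_mul_onQubits (h.trans (n.le_add_right M))]

theorem alloc_source {M : ℕ} {m : Cmd} (h : m.Source) : (alloc M m).Source := by
  induction M generalizing m with
  | zero => exact h
  | succ M ih => exact ih (by simpa only [Cmd.Source] using h)

theorem alloc_typed {n M : ℕ} {Γ : List Ty} {m : Cmd} {τ : Ty}
    (h : CmdTy (n + M) (allocCtx n Γ M) m τ) (hτ : τ.Mobile) : CmdTy n Γ (alloc M m) τ := by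
  induction M generalizing m with
  | zero => exact h
  | succ M ih => exact ih (.new h hτ)

theorem closed_allocEnv {n : ℕ} {σ : ℕ → Exp} (hσ : ∀ x, (σ x).Closed) (M : ℕ) :
    ∀ x, (allocEnv n σ M x).Closed := by
  induction M with
  | zero => exact hσ
  | succ M ih => exact closed_extendEnv (Exp.closed_qloc _) ih

theorem alloc_runs {n M : ℕ} {σ : ℕ → Exp} (hσ : ∀ x, (σ x).Closed) {m : Cmd}
    {Φ : (Exp → Matrix (Bits (n + M)) (Bits (n + M)) ℂ) → Matrix (Bits (n + M)) (Bits (n + M)) ℂ}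
    (h : Runs (n + M) (m.subst (allocEnv n σ M)) Φ) :
    Runs n ((alloc M m).subst σ) fun B =>
      (padMat (n + M) n)ᴴ * Φ (fun v => extendObs (B v) M) * padMat (n + M) n := by
  induction M generalizing m with
  | zero =>
    have h₁ : padMat (n + 0) n = 1 := padMat_self n
    simp only [h₁, Matrix.conjTranspose_one, Matrix.one_mul, Matrix.mul_one]
    exact h
  | succ M ih =>
    have h' := runs_new (n := n + M) (m := m.subst (liftSub (allocEnv n σ M))) (Φ := Φ) <| by
      rw [Cmd.subst_liftSub_subst_single (closed_allocEnv hσ M)]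
      exact h
    convert ih (m := .new m) (by simpa only [Cmd.subst] using h') using 2
    · rfl
    rename_i B
    have hp : padMat (n + (M + 1)) n = padMat (n + M + 1) (n + M) * padMat (n + M) n :=
      (padMat_mul_padMat (n.le_add_right M)).symm
    rw [hp, Matrix.conjTranspose_mul]
    simp only [Matrix.mul_assoc, extendObs]

/-! ### The program of a dilation -/

/-- The variable that refers to qubit `q` inside `M` allocations on top of `N` qubits: the
latter are shifted by `M`, while the new ones appear in reverse order of allocation. -/
def allocVar (N M q : ℕ) : ℕ := if q < N then M + q else N + M - 1 - q

theorem allocVar_succ {N M q : ℕ} (h : q < N + M) : allocVar N (M + 1) q = allocVar N M q + 1 := by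
  unfold allocVar
  split_ifs <;> omega

theorem allocVar_last (N M : ℕ) : allocVar N (M + 1) (N + M) = 0 := by
  unfold allocVar
  split_ifs <;> omega

theorem allocEnv_allocVar {N M q : ℕ} (h : q < N + M) :
    allocEnv N .qloc M (allocVar N M q) = .qloc q := by
  induction M with
  | zero => simp [allocEnv, allocVar, show q < N from h]
  | succ M ih =>
    obtain h | rfl : q < N + M ∨ q = N + M := by omega
    · rw [allocVar_succ h]
      exact ih h
    · rw [allocVar_last]
      rfl

theorem allocCtx_allocVar {N M q : ℕ} (h : q < N + M) :
    (allocCtx N (qubitCtx N) M)[allocVar N M q]? = some (.qref q) := by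
  induction M with
  | zero =>
    have h' : q < N := h
    simp [allocCtx, allocVar, qubitCtx, h']
  | succ M ih =>
    obtain h | rfl : q < N + M ∨ q = N + M := by omega
    · rw [allocVar_succ h]
      exact ih h
    · rw [allocVar_last]
      rfl

/-- Allocate `M` qubits, apply `U` to all `N + M` qubits, measure the new ones, and report the
outcome that `o` assigns to the results. -/
def dilationCmd {k N M : ℕ} (U : Matrix.unitaryGroup (Bits (N + M)) ℂ) (o : Bits M → Fin k) : Cmd :=
  alloc M <| .bnd
    (.cmd (.gate (N + M) U (.tuple (N + M) fun q => .var (allocVar N M q))))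
    (measTree (fun j => allocVar N M (Fin.natAdd N j) + 1) o)

theorem dilationCmd_source {k N M : ℕ} (U : Matrix.unitaryGroup (Bits (N + M)) ℂ)
    (o : Bits M → Fin k) : (dilationCmd U o).Source :=
  alloc_source <| by simp only [Cmd.Source, Exp.Source, measTree_source, implies_true, and_self]

theorem dilationCmd_typed {k N M : ℕ} (U : Matrix.unitaryGroup (Bits (N + M)) ℂ)
    (o : Bits M → Fin k) : CmdTy N (qubitCtx N) (dilationCmd U o) (outcomeTy k) := by
  refine alloc_typed ?_ ?_
  · refine .bnd (.cmd (.gate (.tuple fun q => .var (allocCtx_allocVar q.2))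
      (.tuple fun q : Fin (N + M) => (q : ℕ)) (fun q => q.2) Fin.val_injective)) ?_
    exact measTree_typed (v := fun j => allocVar N M (Fin.natAdd N j) + 1) (c := Fin.natAdd N)
      (fun j => allocCtx_allocVar (Fin.natAdd N j).2) o
  · simp only [outcomeTy, Ty.Mobile, implies_true]

theorem dilationCmd_runs {k N M : ℕ} (U : Matrix.unitaryGroup (Bits (N + M)) ℂ)
    (o : Bits M → Fin k) :
    Runs N ((dilationCmd U o).subst .qloc) fun B =>
      (padMat (N + M) N)ᴴ * (U.1ᴴ * (∑ s, (jointProj (Fin.natAdd N) s)ᴴ *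
        extendObs (B (outcome (o s))) M * jointProj (Fin.natAdd N) s) * U.1) *
          padMat (N + M) N := by
  have hσ := closed_allocEnv (n := N) Exp.closed_qloc M
  refine alloc_runs (Φ := fun B => U.1ᴴ * (∑ s, (jointProj (Fin.natAdd N) s)ᴴ *
    B (outcome (o s)) * jointProj (Fin.natAdd N) s) * U.1) Exp.closed_qloc ?_
  simp only [Cmd.subst, Exp.subst, allocEnv_allocVar (Fin.is_lt _)]
  have := runs_bnd (n := N + M) (Ψ := fun _ B => ∑ s, (jointProj (Fin.natAdd N) s)ᴴ *
    B (outcome (o s)) * jointProj (Fin.natAdd N) s)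
    (m₂ := (measTree (fun j => allocVar N M (Fin.natAdd N j) + 1) o).subst
      (liftSub (allocEnv N .qloc M)))
    (.cmd _) (.gate (U := U) (q := id) (.tuple fun q => .qloc q) (.tuple _) Function.injective_id)
    fun b hb => ?_
  · simpa [Instr.pullback, onQubits_id] using this
  · rw [List.mem_singleton.1 hb, Cmd.subst_liftSub_subst_single hσ]
    exact measTree_runs (v := fun j => allocVar N M (Fin.natAdd N j) + 1)
      (closed_extendEnv Exp.closed_unit hσ) (fun j => allocEnv_allocVar (Fin.natAdd N j).2) o

theorem outcomeObs_outcome {k N : ℕ} {d : Fin k → ℕ} (hd : ∀ i, d i ≤ N) (A : ∀ i, MatAlg (d i))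
    (i : Fin k) : outcomeObs hd A (outcome i) =
      onQubits (CStarMatrix.ofMatrix.symm (A i)) (Fin.castLE (hd i)) := by
  simp [outcomeObs, outcome_injective.eq_iff]

end LambdaQ

theorem mainTheorem2 (k : ℕ) (d : Fin k → ℕ) (p : ℕ)
    (f : (∀ i, LambdaQ.MatAlg (d i)) →CP LambdaQ.MatAlg p) (hf : f 1 = 1)
    (N : ℕ) (hp : p ≤ N) (hd : ∀ i, d i ≤ N) :
    ∃ m : LambdaQ.Cmd, m.Source ∧
      LambdaQ.CmdTy N (LambdaQ.qubitCtx N) m (LambdaQ.outcomeTy k) ∧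
      LambdaQ.Implements hp hd m f := by
  obtain ⟨M, o, U, h⟩ := LambdaQ.exists_unitary_dilation f hf hp hd
  obtain ⟨L, hL, -, hΦ⟩ := LambdaQ.dilationCmd_runs U o
  refine ⟨_, LambdaQ.dilationCmd_source U o, LambdaQ.dilationCmd_typed U o, L, hL, fun A => ?_⟩
  rw [hΦ, ← h A]
  simp only [LambdaQ.outcomeObs_outcome, LambdaQ.extendObs_onQubits]
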